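/- **Setting.** An online MDP has a finite state space $S$, a finite non-empty action set $A$, a fixed transition model $P(x'\mid x,a)$, an initial state distribution $\mu_0$, and $L$ loss vectors $\boldsymbol l_1,\dots,\boldsymbol l_L\in[0,1]^{S\times A}$; let $\Delta_L$ be the set of their convex combinations. In round $t$ the agent uses a policy $\pi_t(\cdot\mid s)$, and the adversary chooses $\boldsymbol l_t\in\Delta_L$ as an arbitrary fixed function of $\pi_1,\dots,\pi_{t-1}$; write $\boldsymbol l_t^{\pi_t}$ for the losses generated against $\pi_1,\pi_2,\dots$, and $\boldsymbol l_t^{\pi}$ for those generated when the agent always plays a fixed policy $\pi$. The policy regret with respect to $\pi$ is $$R_T(\pi)=\mathbb E\Big[\sum_{t=1}^T \boldsymbol l_t^{\pi_t}(X_t,A_t)\Big]-\mathbb E\Big[\sum_{t=1}^T \boldsymbol l_t^{\pi}(X_t^{\pi},A_t^{\pi})\Big],$$ where $X_1\sim\mu_0$, $A_t\sim\pi_t(\cdot\mid X_t)$, $X_{t+1}\sim P(\cdot\mid X_t,A_t)$, and likewise with $\pi$ in place of every $\pi_t$ for $(X_t^\pi,A_t^\pi)$. **Assumptions.** (Mixing,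 with parameter $\tau>0$.) With $P(\pi)_{s,s'}=\sum_a\pi(a\mid s)P(s'\mid s,a)$, every policy $\pi$ and all distributions $d,d'$ on $S$ satisfy $\|dP(\pi)-d'P(\pi)\|_1\le e^{-1/\tau}\|d-d'\|_1$. Hence $\pi$ has a unique stationary state distribution; let $\boldsymbol d_\pi(s,a)$ be its mass at $s$ times $\pi(a\mid s)$. (Strategic adversary, at horizon $T$.) For every sequence of policies $\pi_1,\pi_2,\dots$ of the agent, $$\max_{\boldsymbol l\in\Delta_L}\Big(\sum_{t=1}^T\langle \boldsymbol l,\boldsymbol d_{\pi_t}\rangle-\sum_{t=1}^T\langle \boldsymbol l_t^{\pi_t},\boldsymbol d_{\pi_t}\rangle\Big)\le\sqrt{\tfrac{T\log L}{2}} .$$ **Algorithm (MDP-Expert).** For a policy $\pi$ and a loss $\boldsymbol l$ let $Q_{\pi,\boldsymbol l}(s,a)=\sum_{t\ge1}\big(\mathbb E[\boldsymbol l(s_t,a_t)\mid s_1=s,a_1=a,\pi]-\langle \boldsymbol l,\boldsymbol d_\pi\rangle\big)$. The agent starts with the uniform policy $\pi_1(a\mid s)=1/|A|$ and, in every state $s$,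 runs Multiplicative Weights Update on the feedback $Q_{\pi_t,\boldsymbol l_t}(s,\cdot)$: $$\pi_{t+1}(a\mid s)=\frac{\pi_t(a\mid s)\,e^{-\mu Q_{\pi_t,\boldsymbol l_t}(s,a)}}{\sum_{b}\pi_t(b\mid s)\,e^{-\mu Q_{\pi_t,\boldsymbol l_t}(s,b)}},\qquad \mu=\frac1{3\tau}\sqrt{\frac{8\log|A|}{T}} .$$ **Theorem.** For every $\tau_0>0$ there is a constant $C$, depending on $\tau_0$ only (so an absolute constant for $\tau\ge1$), such that the following holds for all online MDPs, all $L$, all $\tau\ge\tau_0$, all $T\ge1$, and all adversaries as above. If the mixing assumption holds with parameter $\tau$, the adversary is strategic at horizon $T$, and the agent runs MDP-Expert with the above $\mu$, then for every fixed policy $\pi$ $$R_T(\pi)\le C\big(\sqrt{T\log L}+\tau^2\sqrt{T\log|A|}\big).$$ -/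

import Mathlib

/-!
Online Markov decision processes with a non-oblivious adversary.
Rounds are numbered from `0` in the code: index `t` stands for round `t + 1`.
-/

noncomputable section

namespace OMDP

/-- An online MDP with finite state space `S`, finite action set `A`, transition model
`P(x' | x, a)`, initial state distribution, and the `L` loss vectors of the adversary, which
have entries in `[0, 1]`. -/
structure Model (S A : Type*) [Fintype S] [Fintype A] (L : ℕ) where
  trans : S → A → stdSimplex ℝ S
  init : stdSimplex ℝ S
  loss : Fin L → S → A → ℝ
  loss_mem : ∀ i s a, loss i s a ∈ Set.Icc (0 : ℝ) 1

/-- A (stationary, randomized) policy: `π s a` is the probability `π(a | s)`. -/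
abbrev Policy (S A : Type*) [Fintype A] := S → stdSimplex ℝ A

variable {S A : Type*} [Fintype S] [Fintype A] {L : ℕ}

/-- The set `Δ_L` of all mixtures of the `L` loss vectors. -/
def Model.lossSimplex (M : Model S A L) : Set (S → A → ℝ) :=
  {l | ∃ x ∈ stdSimplex ℝ (Fin L), ∀ s a, l s a = ∑ i, x i * M.loss i s a}

/-- A (non-oblivious) adversary: in every round it chooses an element of `Δ_L` as a function of the
policies that the agent has used in the earlier rounds. -/
abbrev Adversary (M : Model S A L) := (t : ℕ) → (Fin t → Policy S A) → M.lossSimplex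

/-- The loss function chosen in round `t` when the agent uses the policies `p 0, p 1, …`. -/
def Adversary.lossAt {M : Model S A L} (adv : Adversary M) (p : ℕ → Policy S A) (t : ℕ) :
    S → A → ℝ :=
  (adv t fun i => p i : M.lossSimplex)

/-- The state transition matrix `P(π)` acting on (row) vectors: `d ↦ d P(π)`. -/
def Model.push (M : Model S A L) (π : Policy S A) (d : S → ℝ) : S → ℝ :=
  fun s' => ∑ s, d s * ∑ a, π s a * M.trans s a s'

/-- The mixing time assumption with parameter `τ` (in the `ℓ₁` norm). -/
def Model.Mixing (M : Model S A L) (τ : ℝ) : Prop :=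
  ∀ (π : Policy S A) (d d' : stdSimplex ℝ S),
    ∑ s, |M.push π d s - M.push π d' s| ≤ Real.exp (-1 / τ) * ∑ s, |d s - d' s|

/-- `d` is a stationary state distribution of the policy `π`. -/
def Model.IsStationary (M : Model S A L) (π : Policy S A) (d : stdSimplex ℝ S) : Prop :=
  M.push π d = d

/-- The stationary state distribution of `π`
(unique under the mixing assumption, see `Model.Mixing.existsUnique_isStationary`). -/
def Model.stationary (M : Model S A L) (π : Policy S A) : stdSimplex ℝ S :=
  @Classical.epsilon _ ⟨M.init⟩ fun d => M.IsStationary π d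

/-- The average loss `η_l(π) = ⟨l, d_π⟩`, where `d_π(s, a)` is the stationary probability of `s`
times `π(a | s)`. -/
def Model.avgLoss (M : Model S A L) (l : S → A → ℝ) (π : Policy S A) : ℝ :=
  ∑ s, ∑ a, l s a * (M.stationary π s * π s a)

/-- The probability of the path `(x₁, a₁), …, (x_T, a_T)` when the first state-action pair has
distribution `ν` and the agent uses policy `p t` in round `t` afterwards. -/
def Model.pathProb (M : Model S A L) (ν : S → A → ℝ) (p : ℕ → Policy S A) :
    (T : ℕ) → (Fin T → S × A) → ℝ
  | 0, _ => 1
  | 1, ω => ν (ω 0).1 (ω 0).2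
  | n + 2, ω =>
      let x := ω (Fin.last n).castSucc
      let y := ω (Fin.last (n + 1))
      M.pathProb ν p (n + 1) (Fin.init ω) * (M.trans x.1 x.2 y.1 * p (n + 1) y.1 y.2)

/-- The expectation of a function of the first `T` state-action pairs. -/
def Model.expect (M : Model S A L) (ν : S → A → ℝ) (p : ℕ → Policy S A) (T : ℕ)
    (f : (Fin T → S × A) → ℝ) : ℝ :=
  ∑ ω, M.pathProb ν p T ω * f ω

/-- The accumulated loss
`Q_{π,l}(s,a) = E[∑_{t ≥ 1} (l(s_t, a_t) - η_l(π)) | s₁ = s, a₁ = a, π]`,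
i.e. the sum over the rounds of the expected loss in excess of `η_l(π)`. -/
def Model.Q (M : Model S A L) (π : Policy S A) (l : S → A → ℝ) (s : S) (a : A) : ℝ :=
  ∑' n : ℕ, M.expect (fun x b => Set.indicator {(s, a)} (fun _ => (1 : ℝ)) (x, b)) (fun _ => π)
    (n + 1) fun ω => l (ω (Fin.last n)).1 (ω (Fin.last n)).2 - M.avgLoss l π

/-- One step of multiplicative weights with learning rate `μ` and feedback `k`. -/
def mwuStep (μ : ℝ) (w : stdSimplex ℝ A) (k : A → ℝ) : stdSimplex ℝ A :=
  ⟨fun a => w a * Real.exp (-μ * k a) / ∑ b, w b * Real.exp (-μ * k b), by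
    have h0 : ∀ b, 0 ≤ w b * Real.exp (-μ * k b) :=
      fun b => mul_nonneg (stdSimplex.zero_le w b) (Real.exp_pos _).le
    have hpos : 0 < ∑ b, w b * Real.exp (-μ * k b) := by
      refine lt_of_le_of_ne (Finset.sum_nonneg fun b _ => h0 b) fun h => ?_
      have hz := (Finset.sum_eq_zero_iff_of_nonneg fun b _ => h0 b).1 h.symm
      have h1 : ∑ b, w b = 0 := Finset.sum_eq_zero fun b hb =>
        (mul_eq_zero.1 (hz b hb)).resolve_right (Real.exp_pos _).ne'
      rw [stdSimplex.sum_eq_one] at h1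
      exact one_ne_zero h1
    refine ⟨fun a => div_nonneg (h0 a) hpos.le, ?_⟩
    rw [← Finset.sum_div, div_self hpos.ne']⟩

/-- The uniform distribution on the actions. -/
def uniform [Nonempty A] : stdSimplex ℝ A :=
  ⟨fun _ => 1 / (Fintype.card A : ℝ), fun _ => by positivity, by simp⟩

/-- MDP-Expert against the adversary `adv`: starting from the uniform policy, in every state `s`
the agent runs multiplicative weights (learning rate `μ t` in round `t`) with the
feedback `Q_{π_t, l_t}(s, ·)`, where `l_t` is the adversary's reply to the agent's earlier
policies. -/
def mdpExpert [Nonempty A] {M : Model S A L} (adv : Adversary M) (μ : ℕ → ℝ) :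
    ℕ → Policy S A
  | 0 => fun _ => uniform
  | t + 1 => fun s =>
      mwuStep (μ t) (mdpExpert adv μ t s)
        (M.Q (mdpExpert adv μ t) (adv t fun i : Fin t => mdpExpert adv μ i : M.lossSimplex) s)
termination_by t => t
decreasing_by all_goals omega

/-- The expected cumulative loss of the agent over `T` rounds, `E[∑_{t ≤ T} l_t(X_t, A_t)]`, when
it uses the policies `p 0, p 1, …` and the adversary adapts to them. -/
def Adversary.cumLoss {M : Model S A L} (adv : Adversary M) (p : ℕ → Policy S A) (T : ℕ) : ℝ :=
  M.expect (fun s a => M.init s * p 0 s a) p T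
    fun ω => ∑ t : Fin T, adv.lossAt p t (ω t).1 (ω t).2

/-- The policy regret of the agent that uses `p 0, p 1, …` with respect to the fixed policy `π`:
the adversary is allowed to adapt to `π` in the comparison term. -/
def Adversary.policyRegret {M : Model S A L} (adv : Adversary M) (p : ℕ → Policy S A)
    (π : Policy S A) (T : ℕ) : ℝ :=
  adv.cumLoss p T - adv.cumLoss (fun _ => π) T

/-- The adversary has no external regret, at the optimal rate: whatever policies the
agent uses, the regret over `T` rounds with respect to the stationary distributions
is at most `√(T log L / 2)`. -/
def Adversary.Strategic {M : Model S A L} (adv : Adversary M) (T : ℕ) : Prop :=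
  ∀ p : ℕ → Policy S A, ∀ l ∈ M.lossSimplex,
    ∑ t ∈ Finset.range T, M.avgLoss l (p t) -
      ∑ t ∈ Finset.range T, M.avgLoss (adv.lossAt p t) (p t) ≤ √(T * Real.log L / 2)

theorem Model.push_mem (M : Model S A L) (π : Policy S A) (d : stdSimplex ℝ S) :
    M.push π d ∈ stdSimplex ℝ S := by
  refine ⟨fun s' => Finset.sum_nonneg fun s _ => mul_nonneg (stdSimplex.zero_le d s)
    (Finset.sum_nonneg fun a _ => mul_nonneg (stdSimplex.zero_le _ a)
      (stdSimplex.zero_le _ s')), ?_⟩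
  have h : ∀ s, ∑ s', ∑ a, π s a * M.trans s a s' = 1 := fun s => by
    rw [Finset.sum_comm]
    simp [← Finset.mul_sum, stdSimplex.sum_eq_one]
  unfold Model.push
  rw [Finset.sum_comm]
  simp [← Finset.mul_sum, h, stdSimplex.sum_eq_one]

/-- Under the mixing assumption every policy has exactly one stationary state distribution. -/
theorem Model.Mixing.existsUnique_isStationary {M : Model S A L} {τ : ℝ} (hτ : 0 < τ)
    (hM : M.Mixing τ) (π : Policy S A) : ∃! d, M.IsStationary π d := by
  have hc : Real.exp (-1 / τ) < 1 := by
    rw [Real.exp_lt_one_iff]; exact div_neg_of_neg_of_pos (by norm_num) hτ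
  have hcont : Continuous fun d : stdSimplex ℝ S => ∑ s, |M.push π d s - d s| := by
    have : ∀ s, Continuous fun d : stdSimplex ℝ S => d s := fun s =>
      (continuous_apply s).comp continuous_subtype_val
    unfold Model.push
    exact continuous_finsetSum _ fun s _ => ((continuous_finsetSum _ fun s' _ =>
      (this s').mul continuous_const).sub (this s)).abs
  have aux : ∀ d : stdSimplex ℝ S, ∀ e : S → ℝ, ∑ s, |e s - d s| ≤ 0 → e = d := by
    intro d e h
    have h' := (Finset.sum_eq_zero_iff_of_nonneg fun s _ => abs_nonneg (e s - d s)).1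
      (le_antisymm h (Finset.sum_nonneg fun s _ => abs_nonneg _))
    funext s
    exact sub_eq_zero.1 (abs_eq_zero.1 (h' s (Finset.mem_univ s)))
  obtain ⟨d, -, hd⟩ := isCompact_univ.exists_isMinOn ⟨M.init, Set.mem_univ _⟩ hcont.continuousOn
  have hst : M.IsStationary π d := by
    apply aux
    have h1 := hd (Set.mem_univ (⟨M.push π d, M.push_mem π d⟩ : stdSimplex ℝ S))
    have h2 := hM π ⟨M.push π d, M.push_mem π d⟩ d
    have h3 := (show _ ≤ _ from h1).trans h2
    change ∑ s, |M.push π d s - d s| ≤ _ * ∑ s, |M.push π d s - d s| at h3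
    nlinarith
  refine ⟨d, hst, fun e he => stdSimplex.ext (aux d e ?_)⟩
  have h := hM π e d
  rw [show M.push π e = e from he, show M.push π d = d from hst] at h
  nlinarith

end OMDP

end

/-!
Let `Q` be the accumulated loss of the policy `p` for the loss `l`. Since `Q` solves the Bellman
equation, the performance difference identity writes `η_l(p) - η_l(π)` as the average, over the
states `s` drawn from the stationary distribution of `π`, of the gap between the means of `Q s`
under `p s` and under `π s`. The losses `Q s` are bounded by a multiple of the mixing horizon
`K = 1 / (1 - exp (-1 / τ)) ≤ 1 + τ`, so multiplicative weights in every state have small regret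
in the stationary losses. Moreover each step of multiplicative weights moves the policy by
`O(μ K)` in `ℓ₁`, so the policies drift slowly and the actual state distributions track the
stationary ones, up to a total error `O(K + T μ K ^ 3)`.

It remains to compare the losses chosen against the agent with those chosen against `π`. Against
the agent that always plays `π`, the adversary has almost as large an average loss as every fixed
loss in `Δ_L`, hence as every loss that it chose against the agent; averaging over these losses
shows that `π` suffers at least as much from the losses chosen against `π` itself, up to the
external regret of the adversary.
-/

noncomputable section

namespace OMDP

section Simplex

variable {X Y : Type*} [Fintype X] [Fintype Y]

theorem sum_mul_le (d : stdSimplex ℝ X) {f : X → ℝ} {B : ℝ} (hf : ∀ x, f x ≤ B) :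
    ∑ x, d x * f x ≤ B :=
  (convex_Iic B).sum_mem (fun x _ => stdSimplex.zero_le d x) (stdSimplex.sum_eq_one d)
    fun x _ => hf x

theorem abs_sum_mul_le (d : stdSimplex ℝ X) {f : X → ℝ} {B : ℝ} (hf : ∀ x, |f x| ≤ B) :
    |∑ x, d x * f x| ≤ B :=
  abs_le.2 <| (convex_Icc (-B) B).sum_mem (fun x _ => stdSimplex.zero_le d x)
    (stdSimplex.sum_eq_one d) fun x _ => abs_le.1 (hf x)

theorem sum_mul_sub_const (d : stdSimplex ℝ X) (f : X → ℝ) (c : ℝ) :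
    ∑ x, d x * (f x - c) = ∑ x, d x * f x - c := by
  simp only [mul_sub, Finset.sum_sub_distrib, ← Finset.sum_mul, stdSimplex.sum_eq_one, one_mul]

theorem sum_vertex_mul [DecidableEq X] (x : X) (f : X → ℝ) :
    ∑ y, (stdSimplex.vertex (S := ℝ) x) y * f y = f x := by
  simp [Pi.single_apply]

theorem sum_mul_exp_pos (d : stdSimplex ℝ X) (f : X → ℝ) : 0 < ∑ x, d x * Real.exp (f x) := by
  obtain ⟨x, hx, hdx⟩ : ∃ x ∈ Finset.univ, d x ≠ 0 :=
    Finset.exists_ne_zero_of_sum_ne_zero (by simp [stdSimplex.sum_eq_one])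
  exact Finset.sum_pos' (fun y _ => mul_nonneg (stdSimplex.zero_le d y) (Real.exp_pos _).le)
    ⟨x, hx, mul_pos ((stdSimplex.zero_le d x).lt_of_ne' hdx) (Real.exp_pos _)⟩

theorem sum_mul_log_le_sum_mul_log_self (d : stdSimplex ℝ X) {e : stdSimplex ℝ X}
    (he : ∀ x, 0 < e x) :
    ∑ x, d x * Real.log (e x) ≤ ∑ x, d x * Real.log (d x) := by
  have hterm : ∀ x, d x * Real.log (e x) ≤ d x * Real.log (d x) + (e x - d x) := fun x => by
    rcases (stdSimplex.zero_le d x).eq_or_lt with hd | hd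
    · simp [← hd, (he x).le]
    · have hlog := Real.log_le_sub_one_of_pos (div_pos (he x) hd)
      rw [Real.log_div (he x).ne' hd.ne'] at hlog
      have hmul := mul_le_mul_of_nonneg_left hlog hd.le
      rw [mul_sub, mul_sub, mul_div_cancel₀ _ hd.ne'] at hmul
      linarith
  simpa [Finset.sum_add_distrib, stdSimplex.sum_eq_one] using
    Finset.sum_le_sum fun x (_ : x ∈ Finset.univ) => hterm x

/-- The `ℓ₁` distance of two vectors; for probability vectors this is twice the total variation
distance. -/
def l1dist (d e : X → ℝ) : ℝ := ∑ x, |d x - e x|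

theorem l1dist_nonneg (d e : X → ℝ) : 0 ≤ l1dist d e :=
  Finset.sum_nonneg fun _ _ => abs_nonneg _

theorem l1dist_self (d : X → ℝ) : l1dist d d = 0 := by
  simp [l1dist]

theorem l1dist_triangle (d e f : X → ℝ) : l1dist d f ≤ l1dist d e + l1dist e f := by
  rw [l1dist, l1dist, l1dist, ← Finset.sum_add_distrib]
  exact Finset.sum_le_sum fun x _ => abs_sub_le _ _ _

theorem l1dist_le_two (d e : stdSimplex ℝ X) : l1dist d e ≤ 2 :=
  calc l1dist d e ≤ ∑ x, (d x + e x) := Finset.sum_le_sum fun x _ =>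
        abs_sub_le_iff.2
          ⟨by linarith [stdSimplex.zero_le e x], by linarith [stdSimplex.zero_le d x]⟩
    _ = 2 := by
        rw [Finset.sum_add_distrib, stdSimplex.sum_eq_one, stdSimplex.sum_eq_one]; norm_num

theorem abs_sum_mul_sub_sum_mul_le (d e : X → ℝ) {f : X → ℝ} {B : ℝ} (hf : ∀ x, |f x| ≤ B) :
    |∑ x, d x * f x - ∑ x, e x * f x| ≤ B * l1dist d e := by
  rw [← Finset.sum_sub_distrib, l1dist, Finset.mul_sum]
  refine (Finset.abs_sum_le_sum_abs _ _).trans (Finset.sum_le_sum fun x _ => ?_)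
  rw [← sub_mul, abs_mul, mul_comm]
  exact mul_le_mul_of_nonneg_right (hf x) (abs_nonneg _)

theorem sum_abs_sum_mul_stdSimplex_le (v : X → ℝ) (k : X → stdSimplex ℝ Y) :
    ∑ y, |∑ x, v x * k x y| ≤ ∑ x, |v x| :=
  calc ∑ y, |∑ x, v x * k x y| ≤ ∑ y, ∑ x, |v x| * k x y :=
        Finset.sum_le_sum fun y _ => (Finset.abs_sum_le_sum_abs _ _).trans_eq <|
          Finset.sum_congr rfl fun x _ => by
            rw [abs_mul, abs_of_nonneg (stdSimplex.zero_le (k x) y)]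
    _ = ∑ x, |v x| := by
        rw [Finset.sum_comm]
        simp only [← Finset.mul_sum, stdSimplex.sum_eq_one, mul_one]

end Simplex

section MultiplicativeWeights

variable {A : Type*} [Fintype A] {μ : ℝ} {w : stdSimplex ℝ A} {k : A → ℝ}

theorem mwuStep_apply (μ : ℝ) (w : stdSimplex ℝ A) (k : A → ℝ) (a : A) :
    mwuStep μ w k a = w a * Real.exp (-μ * k a) / ∑ b, w b * Real.exp (-μ * k b) := rfl

theorem mwuStep_pos {a : A} (hw : 0 < w a) : 0 < mwuStep μ w k a :=
  div_pos (mul_pos hw (Real.exp_pos _)) (sum_mul_exp_pos w _)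

theorem mul_one_sub_le_mwuStep {b : ℝ} (hk : ∀ a, |μ * k a| ≤ b) (a : A) :
    w a * (1 - 2 * b) ≤ mwuStep μ w k a := by
  have hnormalizer : ∑ c, w c * Real.exp (-μ * k c) ≤ Real.exp b :=
    sum_mul_le w fun c => Real.exp_le_exp.2 (by linarith [(abs_le.1 (hk c)).1])
  rw [mwuStep_apply, mul_div_assoc]
  refine mul_le_mul_of_nonneg_left ?_ (stdSimplex.zero_le w a)
  rw [le_div_iff₀ (sum_mul_exp_pos w _)]
  calc (1 - 2 * b) * ∑ c, w c * Real.exp (-μ * k c)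
      ≤ Real.exp (-(2 * b)) * Real.exp b := by
        gcongr
        · exact (sum_mul_exp_pos w _).le
        · linarith [Real.add_one_le_exp (-(2 * b))]
    _ ≤ Real.exp (-μ * k a) := by
        rw [← Real.exp_add, Real.exp_le_exp]
        linarith [(abs_le.1 (hk a)).2]

theorem l1dist_mwuStep_le {b : ℝ} (hk : ∀ a, |μ * k a| ≤ b) :
    l1dist w (mwuStep μ w k) ≤ 4 * b := by
  have hb : 0 ≤ b := (abs_nonneg _).trans (abs_sum_mul_le w hk)
  have hterm : ∀ a, |w a - mwuStep μ w k a| ≤ 4 * b * w a - (w a - mwuStep μ w k a) := fun a => by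
    have hdrop := mul_one_sub_le_mwuStep (w := w) hk a
    have hbw : 0 ≤ b * w a := mul_nonneg hb (stdSimplex.zero_le w a)
    exact abs_le.2 ⟨by linarith, by linarith⟩
  refine (Finset.sum_le_sum fun a _ => hterm a).trans_eq ?_
  simp only [Finset.sum_sub_distrib, ← Finset.mul_sum, stdSimplex.sum_eq_one]
  ring

theorem sum_mul_log_mwuStep (hw : ∀ a, 0 < w a) (q : stdSimplex ℝ A) :
    ∑ a, q a * Real.log (mwuStep μ w k a) =
      ∑ a, q a * Real.log (w a) - μ * ∑ a, q a * k a -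
        Real.log (∑ b, w b * Real.exp (-μ * k b)) := by
  have hlog : ∀ a, Real.log (mwuStep μ w k a) =
      Real.log (w a) - μ * k a - Real.log (∑ b, w b * Real.exp (-μ * k b)) := fun a => by
    rw [mwuStep_apply, Real.log_div (mul_pos (hw a) (Real.exp_pos _)).ne' (sum_mul_exp_pos w _).ne',
      Real.log_mul (hw a).ne' (Real.exp_pos _).ne', Real.log_exp]
    ring
  simp only [hlog, sum_mul_sub_const]
  simp only [mul_sub, Finset.sum_sub_distrib, Finset.mul_sum, mul_left_comm]

/-- Be the leader: weights that have already seen the feedback `k` do at least as well as `q`, up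
to a potential difference that telescopes over the rounds. -/
theorem mul_lookahead_regret_le (hw : ∀ a, 0 < w a) (q : stdSimplex ℝ A) :
    μ * (∑ a, mwuStep μ w k a * k a - ∑ a, q a * k a) ≤
      ∑ a, q a * Real.log (mwuStep μ w k a) - ∑ a, q a * Real.log (w a) := by
  have hgibbs := sum_mul_log_le_sum_mul_log_self (mwuStep μ w k) hw
  rw [sum_mul_log_mwuStep hw] at hgibbs ⊢
  linarith

theorem mul_round_regret_le {B : ℝ} (hw : ∀ a, 0 < w a) (hk : ∀ a, |k a| ≤ B)
    (q : stdSimplex ℝ A) (hμ : 0 ≤ μ) :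
    μ * (∑ a, w a * k a - ∑ a, q a * k a) ≤
      ∑ a, q a * Real.log (mwuStep μ w k a) - ∑ a, q a * Real.log (w a) + 4 * (μ * B) ^ 2 := by
  have hμk : ∀ a, |μ * k a| ≤ μ * B := fun a => by
    rw [abs_mul, abs_of_nonneg hμ]
    exact mul_le_mul_of_nonneg_left (hk a) hμ
  have hμB : 0 ≤ μ * B := (abs_nonneg _).trans (abs_sum_mul_le w hμk)
  have hstability : μ * (∑ a, w a * k a - ∑ a, mwuStep μ w k a * k a) ≤ 4 * (μ * B) ^ 2 :=
    calc μ * (∑ a, w a * k a - ∑ a, mwuStep μ w k a * k a)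
        ≤ μ * (B * l1dist w (mwuStep μ w k)) := by
          gcongr
          exact (le_abs_self _).trans (abs_sum_mul_sub_sum_mul_le _ _ hk)
      _ = μ * B * l1dist w (mwuStep μ w k) := by ring
      _ ≤ μ * B * (4 * (μ * B)) := by gcongr; exact l1dist_mwuStep_le hμk
      _ = 4 * (μ * B) ^ 2 := by ring
  linarith [mul_lookahead_regret_le (μ := μ) (k := k) hw q]

theorem mwu_regret_le {B : ℝ} (hμ : 0 < μ) {w : ℕ → stdSimplex ℝ A} {k : ℕ → A → ℝ}
    (hw : ∀ a, 0 < w 0 a) (hstep : ∀ t, w (t + 1) = mwuStep μ (w t) (k t))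
    (hk : ∀ t a, |k t a| ≤ B) (q : stdSimplex ℝ A) (T : ℕ) :
    ∑ t ∈ Finset.range T, (∑ a, w t a * k t a - ∑ a, q a * k t a) ≤
      (-∑ a, q a * Real.log (w 0 a)) / μ + T * (4 * μ * B ^ 2) := by
  have hpos : ∀ t a, 0 < w t a := fun t => by
    induction t with
    | zero => exact hw
    | succ t ih => exact fun a => hstep t ▸ mwuStep_pos (ih a)
  have hpotential : ∑ a, q a * Real.log (w T a) ≤ 0 :=
    sum_mul_le q fun a => Real.log_nonpos (stdSimplex.zero_le _ a) (stdSimplex.le_one _ a)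
  have hsum := Finset.sum_le_sum fun t (_ : t ∈ Finset.range T) =>
    mul_round_regret_le (hpos t) (hk t) q hμ.le
  simp only [← hstep, ← Finset.mul_sum, Finset.sum_add_distrib, Finset.sum_const,
    Finset.card_range, nsmul_eq_mul,
    Finset.sum_range_sub fun t => ∑ a, q a * Real.log (w t a)] at hsum
  rw [← mul_le_mul_iff_of_pos_left hμ, mul_add, mul_div_cancel₀ _ hμ.ne']
  linarith

theorem uniform_apply [Nonempty A] (a : A) :
    (uniform : stdSimplex ℝ A) a = 1 / (Fintype.card A : ℝ) := rfl

theorem neg_sum_mul_log_uniform [Nonempty A] (q : stdSimplex ℝ A) :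
    -∑ a, q a * Real.log ((uniform : stdSimplex ℝ A) a) = Real.log (Fintype.card A) := by
  simp only [uniform_apply, ← Finset.sum_mul, stdSimplex.sum_eq_one, one_div, Real.log_inv,
    one_mul, neg_neg]

end MultiplicativeWeights

section MixingHorizon

variable {τ : ℝ}

/-- The effective mixing time, i.e. the sum of the powers of the contraction factor
`exp (-1 / τ)`. -/
def mixingHorizon (τ : ℝ) : ℝ := (1 - Real.exp (-1 / τ))⁻¹

theorem exp_neg_one_div_lt_one (hτ : 0 < τ) : Real.exp (-1 / τ) < 1 :=
  Real.exp_lt_one_iff.2 (div_neg_of_neg_of_pos neg_one_lt_zero hτ)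

theorem hasSum_exp_pow_mixingHorizon (hτ : 0 < τ) :
    HasSum (fun n => Real.exp (-1 / τ) ^ n) (mixingHorizon τ) :=
  hasSum_geometric_of_lt_one (Real.exp_pos _).le (exp_neg_one_div_lt_one hτ)

theorem one_le_mixingHorizon (hτ : 0 < τ) : 1 ≤ mixingHorizon τ :=
  (one_le_inv₀ (sub_pos.2 (exp_neg_one_div_lt_one hτ))).2 (by linarith [Real.exp_pos (-1 / τ)])

theorem le_mul_mixingHorizon_iff (hτ : 0 < τ) {x y : ℝ} :
    x ≤ y * mixingHorizon τ ↔ (1 - Real.exp (-1 / τ)) * x ≤ y := by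
  rw [mixingHorizon, ← div_eq_mul_inv, le_div_iff₀' (sub_pos.2 (exp_neg_one_div_lt_one hτ))]

theorem mixingHorizon_le (hτ : 0 < τ) : mixingHorizon τ ≤ 1 + τ := by
  have hexp : Real.exp (-1 / τ) ≤ (1 / τ + 1)⁻¹ := by
    rw [neg_div, Real.exp_neg]
    exact inv_anti₀ (by positivity) (Real.add_one_le_exp _)
  have hinv : (1 / τ + 1)⁻¹ = 1 - (1 + τ)⁻¹ := by field_simp; ring
  exact inv_le_of_inv_le₀ (by positivity) (by linarith)

theorem one_sub_mul_sum_range_le {x : ℕ → ℝ} {b c : ℝ} (hx : ∀ n, 0 ≤ x n)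
    (hrec : ∀ n, x (n + 1) ≤ c * x n + b) (T : ℕ) :
    (1 - c) * ∑ t ∈ Finset.range T, x t ≤ x 0 + T * b := by
  suffices h : (1 - c) * ∑ t ∈ Finset.range T, x t + x T ≤ x 0 + T * b by linarith [hx T]
  induction T with
  | zero => simp
  | succ T ih =>
    rw [Finset.sum_range_succ]
    push_cast
    linarith [hrec T]

end MixingHorizon

section PolicyLoss

variable {S A : Type*} [Fintype A]

/-- The expected loss of the policy `π` in every state. -/
def policyLoss (π : Policy S A) (l : S → A → ℝ) : S → ℝ := fun s => ∑ a, π s a * l s a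

theorem abs_policyLoss_le {l : S → A → ℝ} {B : ℝ} (hl : ∀ s a, |l s a| ≤ B) (π : Policy S A)
    (s : S) : |policyLoss π l s| ≤ B := abs_sum_mul_le (π s) (hl s)

end PolicyLoss

variable {S A : Type*} [Fintype S] [Fintype A] {L : ℕ}

section Law

/-- The transition probabilities of the chain of state-action pairs under the policy `π`. -/
def Model.pairTrans (M : Model S A L) (π : Policy S A) (x y : S × A) : ℝ :=
  M.trans x.1 x.2 y.1 * π y.1 y.2

/-- The law of the state-action pair of round `n` when the first pair has law `ν`; as in
`Model.pathProb`, the policy `p 0` plays no role. -/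
def Model.pairLaw (M : Model S A L) (ν : S → A → ℝ) (p : ℕ → Policy S A) : ℕ → S × A → ℝ
  | 0 => fun x => ν x.1 x.2
  | n + 1 => fun y => ∑ x, M.pairLaw ν p n x * M.pairTrans (p (n + 1)) x y

/-- The map `d ↦ d P(π)` on state distributions. -/
def Model.step (M : Model S A L) (π : Policy S A) (d : stdSimplex ℝ S) : stdSimplex ℝ S :=
  ⟨M.push π d, M.push_mem π d⟩

/-- The law of the state of round `n` when the initial state distribution is `d`. -/
def Model.stateLaw (M : Model S A L) (d : stdSimplex ℝ S) (p : ℕ → Policy S A) : ℕ → stdSimplex ℝ S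
  | 0 => d
  | n + 1 => M.step (p n) (M.stateLaw d p n)

theorem sum_prod_mul_eq_sum_mul_policyLoss (d : S → ℝ) (π : Policy S A) (l : S → A → ℝ) :
    ∑ x : S × A, d x.1 * π x.1 x.2 * l x.1 x.2 = ∑ s, d s * policyLoss π l s := by
  simp only [Fintype.sum_prod_type, policyLoss, Finset.mul_sum, mul_assoc]

variable (M : Model S A L)

theorem Model.avgLoss_eq (l : S → A → ℝ) (π : Policy S A) :
    M.avgLoss l π = ∑ s, M.stationary π s * policyLoss π l s := by
  rw [← sum_prod_mul_eq_sum_mul_policyLoss, Fintype.sum_prod_type]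
  simp only [Model.avgLoss, mul_comm]

theorem Model.push_eq_sum_prod (π : Policy S A) (d : S → ℝ) (s' : S) :
    M.push π d s' = ∑ x : S × A, d x.1 * π x.1 x.2 * M.trans x.1 x.2 s' :=
  (sum_prod_mul_eq_sum_mul_policyLoss d π fun s a => M.trans s a s').symm

theorem Model.sum_pairTrans (π : Policy S A) (x : S × A) : ∑ y, M.pairTrans π x y = 1 := by
  simp only [Model.pairTrans, Fintype.sum_prod_type, ← Finset.mul_sum, stdSimplex.sum_eq_one,
    mul_one]

theorem Model.expect_one (ν : S → A → ℝ) (p : ℕ → Policy S A) (f : (Fin 1 → S × A) → ℝ) :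
    M.expect ν p 1 f = ∑ x : S × A, ν x.1 x.2 * f fun _ => x := by
  rw [Model.expect, ← (Equiv.funUnique (Fin 1) (S × A)).symm.sum_comp]
  rfl

theorem Model.expect_succ_succ (ν : S → A → ℝ) (p : ℕ → Policy S A) (n : ℕ)
    (f : (Fin (n + 2) → S × A) → ℝ) :
    M.expect ν p (n + 2) f = M.expect ν p (n + 1) fun ω =>
      ∑ y, M.pairTrans (p (n + 1)) (ω (Fin.last n)) y *
        f (Fin.snoc (α := fun _ => S × A) ω y) := by
  rw [Model.expect, Model.expect, ← (Fin.snocEquiv fun _ : Fin (n + 2) => S × A).sum_comp,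
    Fintype.sum_prod_type_right]
  simp only [Fin.snocEquiv, Equiv.coe_fn_mk, Model.pathProb, Model.pairTrans, Fin.snoc_castSucc,
    Fin.snoc_last, Fin.init_snoc, Finset.mul_sum, mul_assoc]

theorem Model.expect_add (ν : S → A → ℝ) (p : ℕ → Policy S A) (n : ℕ)
    (f g : (Fin n → S × A) → ℝ) :
    M.expect ν p n (fun ω => f ω + g ω) = M.expect ν p n f + M.expect ν p n g := by
  simp only [Model.expect, mul_add, Finset.sum_add_distrib]

theorem Model.expect_castSucc (ν : S → A → ℝ) (p : ℕ → Policy S A) (n : ℕ)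
    (f : (Fin (n + 1) → S × A) → ℝ) :
    M.expect ν p (n + 2) (fun ω => f fun i => ω i.castSucc) = M.expect ν p (n + 1) f := by
  simp only [M.expect_succ_succ, Fin.snoc_castSucc, ← Finset.sum_mul, M.sum_pairTrans, one_mul]

theorem Model.expect_last (ν : S → A → ℝ) (p : ℕ → Policy S A) (n : ℕ) (f : S × A → ℝ) :
    M.expect ν p (n + 1) (fun ω => f (ω (Fin.last n))) = ∑ x, M.pairLaw ν p n x * f x := by
  induction n generalizing f with
  | zero => exact M.expect_one ν p _
  | succ n ih =>
    simp only [M.expect_succ_succ, Fin.snoc_last]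
    rw [ih fun x => ∑ y, M.pairTrans (p (n + 1)) x y * f y]
    simp only [Model.pairLaw, Finset.mul_sum, Finset.sum_mul, mul_assoc]
    exact Finset.sum_comm

theorem Model.expect_sum (ν : S → A → ℝ) (p : ℕ → Policy S A) (T : ℕ) (f : ℕ → S × A → ℝ) :
    M.expect ν p T (fun ω => ∑ t : Fin T, f t (ω t)) =
      ∑ t ∈ Finset.range T, ∑ x, M.pairLaw ν p t x * f t x := by
  induction T with
  | zero => simp [Model.expect]
  | succ T ih =>
    rw [Finset.sum_range_succ, ← ih, ← M.expect_last]
    cases T with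
    | zero => simp [Model.expect]
    | succ T =>
      simp only [Fin.sum_univ_castSucc (n := T + 1), M.expect_add]
      congr 1
      exact M.expect_castSucc ν p T fun ω => ∑ t : Fin (T + 1), f t (ω t)

theorem Model.pairLaw_prod (d : stdSimplex ℝ S) (p : ℕ → Policy S A) (n : ℕ) (x : S × A) :
    M.pairLaw (fun s a => d s * p 0 s a) p n x = M.stateLaw d p n x.1 * p n x.1 x.2 := by
  induction n generalizing x with
  | zero => rfl
  | succ n ih =>
    simp only [Model.pairLaw, ih, Model.pairTrans, ← mul_assoc, ← Finset.sum_mul]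
    rw [← M.push_eq_sum_prod]
    rfl

theorem Model.pairLaw_succ_eq_shift (ν : S → A → ℝ) (p : ℕ → Policy S A) (n : ℕ) :
    M.pairLaw ν p (n + 1) =
      M.pairLaw (fun s a => M.pairLaw ν p 1 (s, a)) (fun k => p (k + 1)) n := by
  induction n with
  | zero => rfl
  | succ n ih => rw [Model.pairLaw, ih]; rfl

theorem Model.pairLaw_indicator_succ (s : S) (a : A) (p : ℕ → Policy S A) (n : ℕ) (x : S × A) :
    M.pairLaw (fun s' a' => Set.indicator {(s, a)} (fun _ => (1 : ℝ)) (s', a')) p (n + 1) x =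
      M.stateLaw (M.trans s a) (fun k => p (k + 1)) n x.1 * p (n + 1) x.1 x.2 := by
  classical
  rw [M.pairLaw_succ_eq_shift, ← M.pairLaw_prod (M.trans s a) (fun k => p (k + 1))]
  simp [Model.pairLaw, Model.pairTrans, Set.indicator_apply]

theorem Adversary.cumLoss_eq {M : Model S A L} (adv : Adversary M) (p : ℕ → Policy S A) (T : ℕ) :
    adv.cumLoss p T = ∑ t ∈ Finset.range T,
      ∑ s, M.stateLaw M.init p t s * policyLoss (p t) (adv.lossAt p t) s := by
  rw [Adversary.cumLoss, M.expect_sum _ p T fun t x => adv.lossAt p t x.1 x.2]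
  simp only [M.pairLaw_prod, sum_prod_mul_eq_sum_mul_policyLoss]

end Law

section MixingChain

variable {M : Model S A L} {τ : ℝ}

theorem Model.Mixing.l1dist_step_le (hM : M.Mixing τ) (π : Policy S A) (d e : stdSimplex ℝ S) :
    l1dist (M.step π d) (M.step π e) ≤ Real.exp (-1 / τ) * l1dist d e := hM π d e

theorem Model.Mixing.step_stationary (hM : M.Mixing τ) (hτ : 0 < τ) (π : Policy S A) :
    M.step π (M.stationary π) = M.stationary π :=
  stdSimplex.ext (Classical.epsilon_spec (hM.existsUnique_isStationary hτ π).exists)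

theorem Model.Mixing.l1dist_stateLaw_stationary_le (hM : M.Mixing τ) (hτ : 0 < τ)
    (π : Policy S A) (d : stdSimplex ℝ S) (n : ℕ) :
    l1dist (M.stateLaw d (fun _ => π) n) (M.stationary π) ≤ 2 * Real.exp (-1 / τ) ^ n := by
  induction n with
  | zero => exact (l1dist_le_two _ _).trans_eq (by simp)
  | succ n ih =>
    calc l1dist (M.stateLaw d (fun _ => π) (n + 1)) (M.stationary π)
        = l1dist (M.step π (M.stateLaw d (fun _ => π) n)) (M.step π (M.stationary π)) := by
          rw [hM.step_stationary hτ, Model.stateLaw]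
      _ ≤ Real.exp (-1 / τ) * l1dist (M.stateLaw d (fun _ => π) n) (M.stationary π) :=
          hM.l1dist_step_le π _ _
      _ ≤ Real.exp (-1 / τ) * (2 * Real.exp (-1 / τ) ^ n) := by gcongr
      _ = 2 * Real.exp (-1 / τ) ^ (n + 1) := by ring

end MixingChain

section Bias

/-- The expectation of `f` at the next state under the policy `π`, as a function of the current
state; the transpose of `Model.push`. -/
def Model.backup (M : Model S A L) (π : Policy S A) (f : S → ℝ) : S → ℝ :=
  policyLoss π fun s a => ∑ s', M.trans s a s' * f s'

/-- The expected excess of the loss of round `n` over the average loss of `π`, as a function of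
the first state. -/
def Model.excess (M : Model S A L) (π : Policy S A) (l : S → A → ℝ) (n : ℕ) : S → ℝ :=
  fun s => (M.backup π)^[n] (policyLoss π l) s - M.avgLoss l π

/-- The bias function of `π` for the loss `l`: the total expected excess over the average loss, as
a function of the first state. It is the solution of the Bellman equation
`Model.Mixing.bias_eq`. -/
def Model.bias (M : Model S A L) (π : Policy S A) (l : S → A → ℝ) : S → ℝ :=
  fun s => ∑' n, M.excess π l n s

variable (M : Model S A L)

theorem Model.sum_push_mul (π : Policy S A) (d f : S → ℝ) :
    ∑ s, M.push π d s * f s = ∑ s, d s * M.backup π f s := by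
  rw [Model.backup, ← sum_prod_mul_eq_sum_mul_policyLoss]
  simp only [M.push_eq_sum_prod, Finset.sum_mul, Finset.mul_sum, mul_assoc]
  exact Finset.sum_comm

theorem Model.sum_stateLaw_mul (π : Policy S A) (d : stdSimplex ℝ S) (n : ℕ) (f : S → ℝ) :
    ∑ s, M.stateLaw d (fun _ => π) n s * f s = ∑ s, d s * (M.backup π)^[n] f s := by
  induction n generalizing f with
  | zero => rfl
  | succ n ih =>
    rw [Function.iterate_succ_apply, ← ih]
    exact M.sum_push_mul π _ f

theorem Model.sum_mul_excess (π : Policy S A) (l : S → A → ℝ) (n : ℕ) (d : stdSimplex ℝ S) :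
    ∑ s, d s * M.excess π l n s =
      ∑ s, M.stateLaw d (fun _ => π) n s * policyLoss π l s - M.avgLoss l π := by
  simp only [Model.excess, sum_mul_sub_const, M.sum_stateLaw_mul]

theorem Model.excess_succ (π : Policy S A) (l : S → A → ℝ) (n : ℕ) :
    M.excess π l (n + 1) = M.backup π (M.excess π l n) := by
  funext s
  simp only [Model.excess, Function.iterate_succ_apply', Model.backup, policyLoss,
    sum_mul_sub_const]

theorem Model.expect_indicator_one (π : Policy S A) (s : S) (a : A) (f : S × A → ℝ) :
    M.expect (fun x b => Set.indicator {(s, a)} (fun _ => (1 : ℝ)) (x, b)) (fun _ => π) 1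
      (fun ω => f (ω (Fin.last 0))) = f (s, a) := by
  classical
  rw [M.expect_one]
  simp [Set.indicator_apply]

theorem Model.expect_indicator_excess (π : Policy S A) (l : S → A → ℝ) (s : S) (a : A) (n : ℕ) :
    M.expect (fun x b => Set.indicator {(s, a)} (fun _ => (1 : ℝ)) (x, b)) (fun _ => π) (n + 2)
      (fun ω => l (ω (Fin.last (n + 1))).1 (ω (Fin.last (n + 1))).2 - M.avgLoss l π) =
        ∑ s', M.trans s a s' * M.excess π l n s' := by
  rw [M.expect_last _ _ _ fun x => l x.1 x.2 - M.avgLoss l π, M.sum_mul_excess,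
    ← sum_mul_sub_const]
  simp only [M.pairLaw_indicator_succ]
  rw [sum_prod_mul_eq_sum_mul_policyLoss _ π fun s a => l s a - M.avgLoss l π]
  simp only [policyLoss, sum_mul_sub_const]

theorem Model.abs_avgLoss_le {l : S → A → ℝ} {B : ℝ} (hl : ∀ s a, |l s a| ≤ B)
    (π : Policy S A) : |M.avgLoss l π| ≤ B := by
  rw [M.avgLoss_eq]
  exact abs_sum_mul_le _ (abs_policyLoss_le hl π)

variable {M} {τ B : ℝ} {l : S → A → ℝ}

theorem Model.Mixing.abs_sum_mul_excess_le (hM : M.Mixing τ) (hτ : 0 < τ)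
    (hl : ∀ s a, |l s a| ≤ B) (hB : 0 ≤ B) (π : Policy S A) (n : ℕ) (d : stdSimplex ℝ S) :
    |∑ s, d s * M.excess π l n s| ≤ 2 * B * Real.exp (-1 / τ) ^ n :=
  calc |∑ s, d s * M.excess π l n s|
      ≤ B * l1dist (M.stateLaw d (fun _ => π) n) (M.stationary π) := by
        rw [M.sum_mul_excess, M.avgLoss_eq]
        exact abs_sum_mul_sub_sum_mul_le _ _ (abs_policyLoss_le hl π)
    _ ≤ B * (2 * Real.exp (-1 / τ) ^ n) := by
        gcongr
        exact hM.l1dist_stateLaw_stationary_le hτ π d n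
    _ = 2 * B * Real.exp (-1 / τ) ^ n := by ring

theorem Model.Mixing.abs_excess_le (hM : M.Mixing τ) (hτ : 0 < τ) (hl : ∀ s a, |l s a| ≤ B)
    (hB : 0 ≤ B) (π : Policy S A) (n : ℕ) (s : S) :
    |M.excess π l n s| ≤ 2 * B * Real.exp (-1 / τ) ^ n := by
  classical
  simpa only [sum_vertex_mul] using
    hM.abs_sum_mul_excess_le hτ hl hB π n (stdSimplex.vertex (S := ℝ) s)

theorem Model.Mixing.summable_excess (hM : M.Mixing τ) (hτ : 0 < τ) (π : Policy S A)
    (l : S → A → ℝ) (s : S) : Summable fun n => M.excess π l n s := by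
  have hl : ∀ s a, |l s a| ≤ ∑ s, ∑ a, |l s a| := fun s a =>
    (Finset.single_le_sum (fun a _ => abs_nonneg (l s a)) (Finset.mem_univ a)).trans
      (Finset.single_le_sum (f := fun s => ∑ a, |l s a|)
        (fun s _ => Finset.sum_nonneg fun a _ => abs_nonneg (l s a)) (Finset.mem_univ s))
  exact .of_norm_bounded ((hasSum_exp_pow_mixingHorizon hτ).summable.mul_left _) fun n =>
    hM.abs_excess_le hτ hl (by positivity) π n s

theorem Model.Mixing.abs_bias_le (hM : M.Mixing τ) (hτ : 0 < τ) (hl : ∀ s a, |l s a| ≤ B)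
    (hB : 0 ≤ B) (π : Policy S A) (s : S) :
    |M.bias π l s| ≤ 2 * B * mixingHorizon τ := by
  rw [← Real.norm_eq_abs, Model.bias]
  exact tsum_of_norm_bounded ((hasSum_exp_pow_mixingHorizon hτ).mul_left _) fun n =>
    hM.abs_excess_le hτ hl hB π n s

theorem Model.Mixing.hasSum_trans_mul_excess (hM : M.Mixing τ) (hτ : 0 < τ) (π : Policy S A)
    (l : S → A → ℝ) (s : S) (a : A) :
    HasSum (fun n => ∑ s', M.trans s a s' * M.excess π l n s')
      (∑ s', M.trans s a s' * M.bias π l s') :=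
  hasSum_sum fun s' _ => (hM.summable_excess hτ π l s').hasSum.mul_left _

theorem Model.Mixing.bias_eq (hM : M.Mixing τ) (hτ : 0 < τ) (π : Policy S A) (l : S → A → ℝ)
    (s : S) :
    M.bias π l s = policyLoss π l s - M.avgLoss l π + M.backup π (M.bias π l) s := by
  have hbackup : HasSum (fun n => M.backup π (M.excess π l n) s) (M.backup π (M.bias π l) s) :=
    hasSum_sum fun a _ => (hM.hasSum_trans_mul_excess hτ π l s a).mul_left _
  rw [Model.bias, (hM.summable_excess hτ π l s).tsum_eq_zero_add, ← hbackup.tsum_eq]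
  simp only [M.excess_succ]
  rfl

theorem Model.Mixing.Q_eq (hM : M.Mixing τ) (hτ : 0 < τ) (π : Policy S A) (l : S → A → ℝ)
    (s : S) (a : A) :
    M.Q π l s a = l s a - M.avgLoss l π + ∑ s', M.trans s a s' * M.bias π l s' := by
  have htail := hM.hasSum_trans_mul_excess hτ π l s a
  have hterm := M.expect_indicator_excess π l s a
  rw [Model.Q, Summable.tsum_eq_zero_add]
  · rw [tsum_congr hterm, htail.tsum_eq]
    exact congrArg (· + _) (M.expect_indicator_one π s a fun x => l x.1 x.2 - M.avgLoss l π)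
  · exact (summable_nat_add_iff 1).1 (htail.summable.congr fun n => (hterm n).symm)

theorem Model.Mixing.abs_Q_le (hM : M.Mixing τ) (hτ : 0 < τ) (hl : ∀ s a, |l s a| ≤ B)
    (π : Policy S A) (s : S) (a : A) : |M.Q π l s a| ≤ 4 * B * mixingHorizon τ := by
  have hB : 0 ≤ B := (abs_nonneg _).trans (hl s a)
  have hloss := abs_le.1 (hl s a)
  have havg := abs_le.1 (M.abs_avgLoss_le hl π)
  have hbias := abs_le.1 (abs_sum_mul_le (M.trans s a) (hM.abs_bias_le hτ hl hB π))
  have hBK := mul_le_mul_of_nonneg_left (one_le_mixingHorizon hτ) hB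
  rw [hM.Q_eq hτ, abs_le]
  constructor <;> linarith

theorem Model.Mixing.policyLoss_Q (hM : M.Mixing τ) (hτ : 0 < τ) (p π : Policy S A)
    (l : S → A → ℝ) (s : S) :
    policyLoss π (M.Q p l) s =
      policyLoss π l s - M.avgLoss l p + M.backup π (M.bias p l) s := by
  simp only [policyLoss, hM.Q_eq hτ, mul_add, Finset.sum_add_distrib, sum_mul_sub_const,
    Model.backup]

theorem Model.Mixing.avgLoss_sub_avgLoss (hM : M.Mixing τ) (hτ : 0 < τ) (p π : Policy S A)
    (l : S → A → ℝ) :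
    M.avgLoss l p - M.avgLoss l π =
      ∑ s, M.stationary π s * (policyLoss p (M.Q p l) s - policyLoss π (M.Q p l) s) := by
  have hstationary : ∑ s, M.stationary π s * M.backup π (M.bias p l) s =
      ∑ s, M.stationary π s * M.bias p l s := by
    rw [← M.sum_push_mul]
    exact congrArg (fun d : stdSimplex ℝ S => ∑ s, d s * M.bias p l s) (hM.step_stationary hτ π)
  simp only [hM.policyLoss_Q hτ, ← hM.bias_eq hτ, M.avgLoss_eq l π, mul_sub, mul_add,
    Finset.sum_sub_distrib, Finset.sum_add_distrib, hstationary, ← Finset.sum_mul,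
    stdSimplex.sum_eq_one, one_mul]
  ring

end Bias

section Drift

variable {M : Model S A L} {τ δ : ℝ}

theorem Model.l1dist_push_push_le (M : Model S A L) (p q : Policy S A) (d : stdSimplex ℝ S) :
    l1dist (M.push p d) (M.push q d) ≤ ∑ s, d s * l1dist (p s) (q s) := by
  have hcontract := sum_abs_sum_mul_stdSimplex_le
    (fun x : S × A => d x.1 * (p x.1 x.2 - q x.1 x.2)) fun x => M.trans x.1 x.2
  simp only [abs_mul, abs_of_nonneg (stdSimplex.zero_le d _),
    Fintype.sum_prod_type fun x : S × A => d x.1 * _, ← Finset.mul_sum] at hcontract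
  simpa only [l1dist, M.push_eq_sum_prod, mul_sub, sub_mul, Finset.sum_sub_distrib] using hcontract

theorem Model.Mixing.l1dist_stationary_le (hM : M.Mixing τ) (hτ : 0 < τ) {p q : Policy S A}
    (h : ∀ s, l1dist (p s) (q s) ≤ δ) :
    l1dist (M.stationary p) (M.stationary q) ≤ δ * mixingHorizon τ := by
  rw [le_mul_mixingHorizon_iff hτ]
  have hpush : l1dist (M.step p (M.stationary p)) (M.step q (M.stationary p)) ≤ δ :=
    (M.l1dist_push_push_le p q _).trans (sum_mul_le _ h)
  have hstep := hM.l1dist_step_le q (M.stationary p) (M.stationary q)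
  have htriangle := l1dist_triangle (M.step p (M.stationary p)) (M.step q (M.stationary p))
    (M.step q (M.stationary q))
  simp only [hM.step_stationary hτ] at hpush hstep htriangle
  linarith

theorem Model.Mixing.sum_l1dist_stateLaw_le (hM : M.Mixing τ) (hτ : 0 < τ) (d : stdSimplex ℝ S)
    {p : ℕ → Policy S A} (h : ∀ t s, l1dist (p t s) (p (t + 1) s) ≤ δ) (T : ℕ) :
    ∑ t ∈ Finset.range T, l1dist (M.stateLaw d p t) (M.stationary (p t)) ≤
      (2 + T * (δ * mixingHorizon τ)) * mixingHorizon τ := by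
  have hrec : ∀ t, l1dist (M.stateLaw d p (t + 1)) (M.stationary (p (t + 1))) ≤
      Real.exp (-1 / τ) * l1dist (M.stateLaw d p t) (M.stationary (p t)) +
        δ * mixingHorizon τ := fun t => by
    have hstep := hM.l1dist_step_le (p t) (M.stateLaw d p t) (M.stationary (p t))
    rw [hM.step_stationary hτ] at hstep
    exact (l1dist_triangle _ (M.stationary (p t)) _).trans
      (add_le_add hstep (hM.l1dist_stationary_le hτ (h t)))
  rw [le_mul_mixingHorizon_iff hτ]
  exact (one_sub_mul_sum_range_le (fun _ => l1dist_nonneg _ _) hrec T).trans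
    (add_le_add_left (l1dist_le_two (M.stateLaw d p 0) _) _)

theorem Adversary.abs_lossAt_le_one (adv : Adversary M) (p : ℕ → Policy S A) (t : ℕ) (s : S)
    (a : A) : |adv.lossAt p t s a| ≤ 1 := by
  obtain ⟨x, hx, hmix⟩ := (adv t fun i => p i).2
  have hloss : ∀ i, |M.loss i s a| ≤ 1 := fun i =>
    abs_le.2 ⟨by linarith [(M.loss_mem i s a).1], (M.loss_mem i s a).2⟩
  rw [Adversary.lossAt, hmix]
  exact abs_sum_mul_le ⟨x, hx⟩ hloss

theorem Adversary.abs_cumLoss_sub_le (adv : Adversary M) (hM : M.Mixing τ) (hτ : 0 < τ)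
    {p : ℕ → Policy S A} (h : ∀ t s, l1dist (p t s) (p (t + 1) s) ≤ δ) (T : ℕ) :
    |adv.cumLoss p T - ∑ t ∈ Finset.range T, M.avgLoss (adv.lossAt p t) (p t)| ≤
      (2 + T * (δ * mixingHorizon τ)) * mixingHorizon τ := by
  refine le_trans ?_ (hM.sum_l1dist_stateLaw_le hτ M.init h T)
  rw [adv.cumLoss_eq, ← Finset.sum_sub_distrib]
  refine (Finset.abs_sum_le_sum_abs _ _).trans (Finset.sum_le_sum fun t _ => ?_)
  rw [M.avgLoss_eq, ← one_mul (l1dist _ _)]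
  exact abs_sum_mul_sub_sum_mul_le _ _ (abs_policyLoss_le (adv.abs_lossAt_le_one p t) (p t))

end Drift

section Regret

variable {M : Model S A L} {T : ℕ} {τ ε μ : ℝ}

/-- The external regret, in stationary losses over `T` rounds, of the adversary against the agent
that uses `p 0, p 1, …` is at most `ε`; `Adversary.Strategic` requires this of all `p` at once. -/
def Adversary.ExternalRegretLE (adv : Adversary M) (p : ℕ → Policy S A) (T : ℕ) (ε : ℝ) : Prop :=
  ∀ l ∈ M.lossSimplex, ∑ t ∈ Finset.range T, M.avgLoss l (p t) -
    ∑ t ∈ Finset.range T, M.avgLoss (adv.lossAt p t) (p t) ≤ ε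

theorem Adversary.ExternalRegretLE.sum_avgLoss_lossAt_sub_le {adv : Adversary M} {π : Policy S A}
    (hadv : adv.ExternalRegretLE (fun _ => π) T ε) (hT : 1 ≤ T) (p : ℕ → Policy S A) :
    ∑ t ∈ Finset.range T, M.avgLoss (adv.lossAt p t) π -
      ∑ t ∈ Finset.range T, M.avgLoss (adv.lossAt (fun _ => π) t) π ≤ ε := by
  have havg := Finset.sum_le_sum fun i (_ : i ∈ Finset.range T) =>
    hadv (adv.lossAt p i) (adv i fun j => p j).2
  simp only [Finset.sum_const, Finset.card_range, nsmul_eq_mul, Finset.sum_sub_distrib,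
    ← Finset.mul_sum] at havg
  rw [← mul_sub] at havg
  exact le_of_mul_le_mul_left havg (Nat.cast_pos.2 hT)

theorem Adversary.policyRegret_of_subsingleton [Subsingleton A] (adv : Adversary M)
    (p : ℕ → Policy S A) (π : Policy S A) (T : ℕ) : adv.policyRegret p π T = 0 := by
  rw [Adversary.policyRegret, Subsingleton.elim p fun _ => π, sub_self]

theorem Adversary.abs_Q_lossAt_le (adv : Adversary M) (hM : M.Mixing τ) (hτ : 0 < τ)
    (p : ℕ → Policy S A) (t : ℕ) (π : Policy S A) (s : S) (a : A) :
    |M.Q π (adv.lossAt p t) s a| ≤ 4 * mixingHorizon τ := by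
  simpa only [mul_one] using hM.abs_Q_le hτ (adv.abs_lossAt_le_one p t) π s a

variable [Nonempty A] (adv : Adversary M)

theorem mdpExpert_zero (μ : ℕ → ℝ) (s : S) : mdpExpert adv μ 0 s = uniform := by
  rw [mdpExpert]

theorem mdpExpert_succ (μ : ℕ → ℝ) (t : ℕ) (s : S) :
    mdpExpert adv μ (t + 1) s = mwuStep (μ t) (mdpExpert adv μ t s)
      (M.Q (mdpExpert adv μ t) (adv.lossAt (mdpExpert adv μ) t) s) := by
  rw [mdpExpert]
  rfl

theorem l1dist_mdpExpert_succ_le (hM : M.Mixing τ) (hτ : 0 < τ) (hμ : 0 ≤ μ) (t : ℕ) (s : S) :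
    l1dist (mdpExpert adv (fun _ => μ) t s) (mdpExpert adv (fun _ => μ) (t + 1) s) ≤
      16 * μ * mixingHorizon τ := by
  rw [mdpExpert_succ]
  refine (l1dist_mwuStep_le (b := μ * (4 * mixingHorizon τ)) fun a => ?_).trans_eq (by ring)
  rw [abs_mul, abs_of_nonneg hμ]
  exact mul_le_mul_of_nonneg_left (adv.abs_Q_lossAt_le hM hτ _ t _ s a) hμ

theorem sum_avgLoss_mdpExpert_sub_le (hM : M.Mixing τ) (hτ : 0 < τ) (hμ : 0 < μ)
    (π : Policy S A) (T : ℕ) :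
    ∑ t ∈ Finset.range T, M.avgLoss (adv.lossAt (mdpExpert adv fun _ => μ) t)
        (mdpExpert adv (fun _ => μ) t) -
      ∑ t ∈ Finset.range T, M.avgLoss (adv.lossAt (mdpExpert adv fun _ => μ) t) π ≤
    Real.log (Fintype.card A) / μ + T * (4 * μ * (4 * mixingHorizon τ) ^ 2) := by
  rw [← Finset.sum_sub_distrib]
  simp only [hM.avgLoss_sub_avgLoss hτ]
  rw [Finset.sum_comm]
  simp only [← Finset.mul_sum]
  refine sum_mul_le _ fun s => ?_
  have hinit : ∀ a, 0 < mdpExpert adv (fun _ => μ) 0 s a := fun a => by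
    rw [mdpExpert_zero, uniform_apply]
    positivity
  have hmwu := mwu_regret_le (w := fun t => mdpExpert adv (fun _ => μ) t s) hμ hinit
    (fun t => mdpExpert_succ adv _ t s) (fun t => adv.abs_Q_lossAt_le hM hτ _ t _ s) (π s) T
  rwa [mdpExpert_zero, neg_sum_mul_log_uniform] at hmwu

theorem policyRegret_mdpExpert_le (hM : M.Mixing τ) (hτ : 0 < τ) (hT : 1 ≤ T) (hμ : 0 < μ)
    {π : Policy S A} (hadv : adv.ExternalRegretLE (fun _ => π) T ε) :
    adv.policyRegret (mdpExpert adv fun _ => μ) π T ≤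
      ε + Real.log (Fintype.card A) / μ + 4 * mixingHorizon τ +
        64 * (T * μ) * mixingHorizon τ ^ 2 + 16 * (T * μ) * mixingHorizon τ ^ 3 := by
  have hagent := (abs_le.1 (adv.abs_cumLoss_sub_le hM hτ
    (l1dist_mdpExpert_succ_le adv hM hτ hμ.le) T)).2
  have hfixed := (abs_le.1 (adv.abs_cumLoss_sub_le (p := fun _ => π) hM hτ
    (fun _ s => (l1dist_self (π s)).le) T)).1
  have hmwu := sum_avgLoss_mdpExpert_sub_le adv hM hτ hμ π T
  have hadversary := hadv.sum_avgLoss_lossAt_sub_le hT (mdpExpert adv fun _ => μ)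
  unfold Adversary.policyRegret
  linear_combination hagent + hfixed + hmwu + hadversary

end Regret

section LearningRate

variable {a T τ : ℝ}

theorem div_learningRate_le (ha : 0 < a) (hT : 0 < T) (hτ : 0 < τ) :
    a / (√(8 * a / T) / (3 * τ)) ≤ 3 * τ * √(T * a) := by
  have hroots : √(T * a) * √(8 * a / T) = √8 * a := by
    rw [← Real.sqrt_mul (by positivity), show T * a * (8 * a / T) = 8 * a ^ 2 by field_simp,
      Real.sqrt_mul (by norm_num), Real.sqrt_sq ha.le]
  have hsqrt : 1 ≤ √8 := Real.one_le_sqrt.2 (by norm_num)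
  rw [div_div_eq_mul_div, div_le_iff₀ (by positivity)]
  calc a * (3 * τ) = 3 * τ * (1 * a) := by ring
    _ ≤ 3 * τ * (√8 * a) := by gcongr
    _ = 3 * τ * √(T * a) * √(8 * a / T) := by rw [← hroots]; ring

theorem mul_learningRate_le (hT : 0 < T) (hτ : 0 < τ) :
    T * (√(8 * a / T) / (3 * τ)) ≤ √(T * a) / τ := by
  have hroots : T * √(8 * a / T) = √8 * √(T * a) := by
    rw [← Real.sqrt_mul (by norm_num), show 8 * (T * a) = T ^ 2 * (8 * a / T) by field_simp,
      Real.sqrt_mul (by positivity), Real.sqrt_sq hT.le]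
  have hsqrt : √8 ≤ 3 := Real.sqrt_le_iff.2 (by norm_num)
  calc T * (√(8 * a / T) / (3 * τ)) = √8 * √(T * a) / (3 * τ) := by rw [← hroots]; ring
    _ ≤ 3 * √(T * a) / (3 * τ) := by gcongr
    _ = √(T * a) / τ := mul_div_mul_left _ _ three_ne_zero

theorem one_le_two_mul_sqrt_mul_log {n : ℕ} (hT : 1 ≤ T) (hn : 2 ≤ n) :
    1 ≤ 2 * √(T * Real.log n) := by
  have hlog : 1 / 2 ≤ Real.log n := calc
    (1 / 2 : ℝ) ≤ Real.log 2 := by linarith [Real.log_two_gt_d9]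
    _ ≤ Real.log n := Real.log_le_log two_pos (Nat.ofNat_le_cast.2 hn)
  have hsqrt : 1 / 2 ≤ √(T * Real.log n) := Real.le_sqrt_of_sq_le (by nlinarith)
  linarith

theorem tuned_regret_le {R K : ℝ} (hτ : 0 < τ) (hK : 0 ≤ K) (hKτ : K ≤ 1 + τ) (hR : 1 ≤ 2 * R) :
    3 * τ * R + 4 * K + 64 * (R / τ) * K ^ 2 + 16 * (R / τ) * K ^ 3 ≤
      91 * ((1 + τ) ^ 3 / τ) * R := by
  have hR0 : 0 ≤ R := by linarith
  have h1τ : 1 ≤ 1 + τ := by linarith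
  have hentropy : 3 * τ * R ≤ 3 * ((1 + τ) ^ 3 / τ * R) := by
    have hsq : τ * τ ≤ (1 + τ) ^ 3 := by nlinarith [pow_pos hτ 3]
    have hdiv : τ ≤ (1 + τ) ^ 3 / τ := (le_div_iff₀ hτ).2 hsq
    rw [mul_assoc]
    gcongr
  have hinitial : 4 * K ≤ 8 * ((1 + τ) ^ 3 / τ * R) := by
    have hsq : (1 + τ) * τ ≤ (1 + τ) ^ 3 := by nlinarith [pow_pos hτ 3]
    have hdiv : K ≤ (1 + τ) ^ 3 / τ := hKτ.trans ((le_div_iff₀ hτ).2 hsq)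
    nlinarith
  have hstability : 64 * (R / τ) * K ^ 2 ≤ 64 * ((1 + τ) ^ 3 / τ * R) := calc
    64 * (R / τ) * K ^ 2 ≤ 64 * (R / τ) * (1 + τ) ^ 3 := by
      gcongr
      exact (pow_le_pow_left₀ hK hKτ 2).trans (pow_le_pow_right₀ h1τ (by norm_num))
    _ = 64 * ((1 + τ) ^ 3 / τ * R) := by ring
  have hdrift : 16 * (R / τ) * K ^ 3 ≤ 16 * ((1 + τ) ^ 3 / τ * R) := calc
    16 * (R / τ) * K ^ 3 ≤ 16 * (R / τ) * (1 + τ) ^ 3 := by gcongr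
    _ = 16 * ((1 + τ) ^ 3 / τ * R) := by ring
  linear_combination hentropy + hinitial + hstability + hdrift

theorem one_add_pow_three_div_le {τ₀ : ℝ} (hτ₀ : 0 < τ₀) (hτ : τ₀ ≤ τ) :
    (1 + τ) ^ 3 / τ ≤ (1 + 1 / τ₀) ^ 3 * τ ^ 2 := by
  have hτpos : 0 < τ := hτ₀.trans_le hτ
  have hone : 1 + τ ≤ (1 + 1 / τ₀) * τ := by
    have : 1 ≤ 1 / τ₀ * τ := by rwa [one_div_mul_eq_div, one_le_div hτ₀]
    linarith
  rw [div_le_iff₀ hτpos]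
  calc (1 + τ) ^ 3 ≤ ((1 + 1 / τ₀) * τ) ^ 3 := by gcongr
    _ = (1 + 1 / τ₀) ^ 3 * τ ^ 2 * τ := by ring

theorem add_mul_rate_le {τ₀ x y R : ℝ} (hτ₀ : 0 < τ₀) (hτ : τ₀ ≤ τ) (hy : 0 ≤ y) (hxy : x ≤ y)
    (hR : 0 ≤ R) :
    x + 91 * ((1 + τ) ^ 3 / τ) * R ≤ (1 + 91 * (1 + 1 / τ₀) ^ 3) * (y + τ ^ 2 * R) :=
  calc x + 91 * ((1 + τ) ^ 3 / τ) * R ≤ y + 91 * ((1 + 1 / τ₀) ^ 3 * τ ^ 2) * R := by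
        gcongr
        exact one_add_pow_three_div_le hτ₀ hτ
    _ ≤ y + 91 * ((1 + 1 / τ₀) ^ 3 * τ ^ 2) * R +
          (91 * (1 + 1 / τ₀) ^ 3 * y + τ ^ 2 * R) := le_add_of_nonneg_right (by positivity)
    _ = (1 + 91 * (1 + 1 / τ₀) ^ 3) * (y + τ ^ 2 * R) := by ring

end LearningRate

end OMDP

end

theorem mainTheorem1_general {S A : Type*} [Fintype S] [Fintype A] [Nonempty A] {L : ℕ}
    {M : OMDP.Model S A L} (adv : OMDP.Adversary M) {τ ε : ℝ} {T : ℕ} (hτ : 0 < τ) (hT : 1 ≤ T)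
    (hM : M.Mixing τ) {π : OMDP.Policy S A} (hadv : adv.ExternalRegretLE (fun _ => π) T ε) :
    adv.policyRegret
        (OMDP.mdpExpert adv fun _ => √(8 * Real.log (Fintype.card A) / T) / (3 * τ)) π T ≤
      ε + 91 * ((1 + τ) ^ 3 / τ) * √(T * Real.log (Fintype.card A)) := by
  rcases subsingleton_or_nontrivial A with hA | hA
  · have hε := hadv.sum_avgLoss_lossAt_sub_le hT fun _ => π
    rw [sub_self] at hε
    rw [adv.policyRegret_of_subsingleton]
    positivity
  · have hT_one : (1 : ℝ) ≤ T := Nat.one_le_cast.2 hT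
    have hlog : 0 < Real.log (Fintype.card A) :=
      Real.log_pos (Nat.one_lt_cast.2 Fintype.one_lt_card)
    have hregret := OMDP.policyRegret_mdpExpert_le adv hM hτ hT
      (μ := √(8 * Real.log (Fintype.card A) / T) / (3 * τ)) (by positivity) hadv
    have hK := OMDP.one_le_mixingHorizon hτ
    have hentropy := OMDP.div_learningRate_le hlog (zero_lt_one.trans_le hT_one) hτ
    have hrate := OMDP.mul_learningRate_le (a := Real.log (Fintype.card A))
      (zero_lt_one.trans_le hT_one) hτ
    have htuned := OMDP.tuned_regret_le hτ (zero_le_one.trans hK) (OMDP.mixingHorizon_le hτ)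
      (OMDP.one_le_two_mul_sqrt_mul_log hT_one (n := Fintype.card A) Fintype.one_lt_card)
    refine hregret.trans (le_trans ?_ (add_le_add_right htuned ε))
    rw [← add_assoc, ← add_assoc, ← add_assoc]
    gcongr

theorem mainTheorem1 :
    ∀ τ₀ : ℝ, 0 < τ₀ → ∃ C : ℝ, 0 < C ∧
      ∀ (S A : Type*) [Fintype S] [Fintype A] [Nonempty A] (L : ℕ)
        (M : OMDP.Model S A L) (adv : OMDP.Adversary M) (τ : ℝ) (T : ℕ),
        τ₀ ≤ τ → 1 ≤ T → M.Mixing τ → adv.Strategic T →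
        ∀ π : OMDP.Policy S A,
          adv.policyRegret
              (OMDP.mdpExpert adv fun _ => √(8 * Real.log (Fintype.card A) / T) / (3 * τ)) π T
            ≤ C * (√(T * Real.log L) + τ ^ 2 * √(T * Real.log (Fintype.card A))) := by
  intro τ₀ hτ₀
  refine ⟨1 + 91 * (1 + 1 / τ₀) ^ 3, by positivity, fun S A _ _ _ L M adv τ T hτ hT hM hadv π => ?_⟩
  have hhalf : √(T * Real.log L / 2) ≤ √(T * Real.log L) :=
    Real.sqrt_le_sqrt (half_le_self (by positivity))
  exact (mainTheorem1_general adv (hτ₀.trans_le hτ) hT hM (hadv fun _ => π)).trans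
    (OMDP.add_mul_rate_le hτ₀ hτ (Real.sqrt_nonneg _) hhalf (Real.sqrt_nonneg _))
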